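/- Let $\mathcal I$ be a non-empty finite set of agents and $P$ a countably infinite set of propositional variables. Formulas are built from $P$, $\top$, $\bot$ by $\land$, $\neg$ and the modal operators $\mathsf K_i$ ($i\in\mathcal I$) and $\mathsf C$; write $\phi\lor\psi=\neg(\neg\phi\land\neg\psi)$, $\phi\supset\psi=\neg\phi\lor\psi$ and $\mathsf E\phi=\bigwedge_{i\in\mathcal I}\mathsf K_i\phi$. Let $\mathbf{CKL}$ be the set of formulas derivable in the proof system $\mathbf{PS}_{\mathrm{MH}}$ with axioms: all tautologies; $\Box(\phi\supset\psi)\supset(\Box\phi\supset\Box\psi)$ for each modal operator $\Box$; $\mathsf C\phi\supset\phi$; $\mathsf C\phi\supset\mathsf E\mathsf C\phi$; $\mathsf C(\phi\supset\mathsf E\phi)\supset(\phi\supset\mathsf C\phi)$; and rules: modus ponens, uniform substitution, and necessitation for each modal operator. A modal algebra is a Boolean algebra $A$ with unary operators $\mathrm K_i$ ($i\in\mathcal I$) and $\mathrm C$ such that $\Box 1=1$ and $\Box(x\sqcap y)=\Box x\sqcap\Box y$ for each operator $\Box$ and all $x,y\in A$; write $\mathrm E x=\bigsqcap_{i\in\mathcal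 I}\mathrm K_i x$. A formula is valid in $A$ if it takes the value $1$ under every valuation $P\to A$. For a set $\Gamma$ of formulas, $\mathsf{Alg}(\Gamma)$ is the class of modal algebras in which all formulas of $\Gamma$ are valid; a class of modal algebras is modally definable if it equals $\mathsf{Alg}(\Gamma)$ for some set $\Gamma$ of formulas. It is equationally definable if it is the class of all modal algebras satisfying some set of equations between terms of the language of modal algebras over some set of variables. It is a variety if it is closed under homomorphic images, subalgebras (up to isomorphism) and direct products. Let $\mathbf A_{\mathrm{CKL}}$ be the class of CKL-algebras, that is, the modal algebras such that, for all $x$, $\mathrm C x\le\mathrm E\mathrm C x$ and $\mathrm C x$ is the greatest lower bound of $\{\mathrm E^n x\mid n\ge 0\}$. Let $\mathbf A_{\mathrm{MH}}$ be the class of MH-algebras, that is, the modal algebras such that, for all $x$, $\mathrm C x\le x$, $\mathrm C x\le\mathrm E\mathrm C x$ and $\mathrm C(-x\sqcup\mathrm E x)\le -x\sqcup\mathrm C x$. Then $\mathsf{Alg}(\mathbf{CKL})=\mathbf A_{\mathrm{MH}}$ and $\mathbf A_{\mathrm{CKL}}\subsetneq\mathbf A_{\mathrm{MH}}$. Moreover,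 $\mathbf A_{\mathrm{CKL}}$ is not modally definable, it is not equationally definable, and it is not a variety. -/

import Mathlib

universe w v u x

namespace CommonKnowledge

/-! ### Formulas of common knowledge logic -/

/-- Formulas over a set `P` of propositional variables and a set `I` of agents. -/
inductive Form (I : Type w) (P : Type v) : Type (max w v)
  | var : P → Form I P
  | top : Form I P
  | bot : Form I P
  | and : Form I P → Form I P → Form I P
  | neg : Form I P → Form I P
  | K : I → Form I P → Form I P
  | C : Form I P → Form I P

namespace Form

variable {I : Type w} {P : Type v}

/-- The disjunction `φ ∨ ψ`, an abbreviation of `¬(¬φ ∧ ¬ψ)`. -/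
def or (φ ψ : Form I P) : Form I P := neg (and (neg φ) (neg ψ))

/-- The implication `φ ⊃ ψ`, an abbreviation of `¬φ ∨ ψ`. -/
def imp (φ ψ : Form I P) : Form I P := or (neg φ) ψ

/-- `E φ`, the conjunction of all `K i φ`. The agents are listed in some fixed order, and
the conjunction of the empty list is `⊤`. -/
noncomputable def E [Fintype I] (φ : Form I P) : Form I P :=
  ((Finset.univ : Finset I).toList.map fun i => K i φ).foldr and top

/-- Uniform substitution of formulas for the propositional variables. -/
def subst (σ : P → Form I P) : Form I P → Form I P
  | var p => σ p
  | top => top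
  | bot => bot
  | and φ ψ => and (subst σ φ) (subst σ ψ)
  | neg φ => neg (subst σ φ)
  | K i φ => K i (subst σ φ)
  | C φ => C (subst σ φ)

/-- Truth under a classical assignment `t` of truth values in which the propositional variables
and all formulas of the form `K i φ` or `C φ` count as atoms. -/
def Holds (t : Form I P → Prop) : Form I P → Prop
  | top => True
  | bot => False
  | and φ ψ => Holds t φ ∧ Holds t ψ
  | neg φ => ¬ Holds t φ
  | var p => t (var p)
  | K i φ => t (K i φ)
  | C φ => t (C φ)

/-- A (classical propositional) tautology in the modal language. -/
def IsTautology (φ : Form I P) : Prop := ∀ t : Form I P → Prop, Holds t φ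

end Form

/-- Derivability in the Meyer--van der Hoek proof system for common knowledge logic. -/
inductive Derivable {I : Type w} [Fintype I] {P : Type v} : Form I P → Prop
  | taut {φ : Form I P} : φ.IsTautology → Derivable φ
  | distribK (i : I) (φ ψ : Form I P) :
      Derivable ((Form.K i (φ.imp ψ)).imp ((Form.K i φ).imp (Form.K i ψ)))
  | distribC (φ ψ : Form I P) :
      Derivable ((Form.C (φ.imp ψ)).imp ((Form.C φ).imp (Form.C ψ)))
  | reflC (φ : Form I P) : Derivable ((Form.C φ).imp φ)
  | stepC (φ : Form I P) : Derivable ((Form.C φ).imp (Form.C φ).E)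
  | indC (φ : Form I P) : Derivable ((Form.C (φ.imp φ.E)).imp (φ.imp (Form.C φ)))
  | mp {φ ψ : Form I P} : Derivable (φ.imp ψ) → Derivable φ → Derivable ψ
  | subst (σ : P → Form I P) {φ : Form I P} : Derivable φ → Derivable (φ.subst σ)
  | necK (i : I) {φ : Form I P} : Derivable φ → Derivable (Form.K i φ)
  | necC {φ : Form I P} : Derivable φ → Derivable (Form.C φ)

/-- The logic **CKL**: the set of all derivable formulas. -/
def CKL (I : Type w) [Fintype I] (P : Type v) : Set (Form I P) := {φ | Derivable φ}

/-! ### Modal algebras -/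

/-- A modal algebra: a Boolean algebra with operators `K i` (for `i : I`) and `C`, each of which
preserves the top element and binary meets. -/
structure ModalAlgebra (I : Type w) : Type (max w (u + 1)) where
  carrier : Type u
  [boolean : BooleanAlgebra carrier]
  K : I → carrier → carrier
  C : carrier → carrier
  K_top : ∀ i, K i ⊤ = ⊤
  K_inf : ∀ i a b, K i (a ⊓ b) = K i a ⊓ K i b
  C_top : C ⊤ = ⊤
  C_inf : ∀ a b, C (a ⊓ b) = C a ⊓ C b

attribute [instance] ModalAlgebra.boolean

namespace ModalAlgebra

variable {I : Type w}

/-- The operator `E`: `E a` is the meet of all `K i a`. -/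
def E [Fintype I] (A : ModalAlgebra.{w, u} I) (a : A.carrier) : A.carrier :=
  Finset.univ.inf fun i => A.K i a

/-- CKL-algebras. -/
def IsCKL [Fintype I] (A : ModalAlgebra.{w, u} I) : Prop :=
  ∀ a : A.carrier, A.C a ≤ A.E (A.C a) ∧ IsGLB (Set.range fun n : ℕ => A.E^[n] a) (A.C a)

/-- MH-algebras. -/
def IsMH [Fintype I] (A : ModalAlgebra.{w, u} I) : Prop :=
  ∀ a : A.carrier, A.C a ≤ a ∧ A.C a ≤ A.E (A.C a) ∧ A.C (aᶜ ⊔ A.E a) ≤ aᶜ ⊔ A.C a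

/-- The value of a formula under a valuation of the propositional variables. -/
def eval {P : Type v} (A : ModalAlgebra.{w, u} I) (val : P → A.carrier) :
    Form I P → A.carrier
  | .var p => val p
  | .top => ⊤
  | .bot => ⊥
  | .and φ ψ => A.eval val φ ⊓ A.eval val ψ
  | .neg φ => (A.eval val φ)ᶜ
  | .K i φ => A.K i (A.eval val φ)
  | .C φ => A.C (A.eval val φ)

/-- Validity of a formula in a modal algebra. -/
def Valid {P : Type v} (A : ModalAlgebra.{w, u} I) (φ : Form I P) : Prop :=
  ∀ val : P → A.carrier, A.eval val φ = ⊤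

/-- Homomorphisms of modal algebras. -/
structure Hom (A B : ModalAlgebra.{w, u} I) where
  toFun : A.carrier → B.carrier
  map_sup : ∀ a b, toFun (a ⊔ b) = toFun a ⊔ toFun b
  map_inf : ∀ a b, toFun (a ⊓ b) = toFun a ⊓ toFun b
  map_compl : ∀ a, toFun aᶜ = (toFun a)ᶜ
  map_bot : toFun ⊥ = ⊥
  map_top : toFun ⊤ = ⊤
  map_K : ∀ i a, toFun (A.K i a) = B.K i (toFun a)
  map_C : ∀ a, toFun (A.C a) = B.C (toFun a)

/-- The direct product of a family of modal algebras. -/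
def pi {ι : Type u} (A : ι → ModalAlgebra.{w, u} I) : ModalAlgebra.{w, u} I where
  carrier := ∀ j, (A j).carrier
  K i a := fun j => (A j).K i (a j)
  C a := fun j => (A j).C (a j)
  K_top i := funext fun j => (A j).K_top i
  K_inf i a b := funext fun j => (A j).K_inf i (a j) (b j)
  C_top := funext fun j => (A j).C_top
  C_inf a b := funext fun j => (A j).C_inf (a j) (b j)

end ModalAlgebra

/-- The class of all CKL-algebras. -/
def CKLAlgebras (I : Type w) [Fintype I] : Set (ModalAlgebra.{w, u} I) := {A | A.IsCKL}

/-- The class of all MH-algebras. -/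
def MHAlgebras (I : Type w) [Fintype I] : Set (ModalAlgebra.{w, u} I) := {A | A.IsMH}

/-- `Alg Γ` is the class of all modal algebras in which every formula of `Γ` is valid. -/
def Alg {I : Type w} {P : Type v} (Γ : Set (Form I P)) : Set (ModalAlgebra.{w, u} I) :=
  {A | ∀ φ ∈ Γ, A.Valid φ}

/-- A class of modal algebras is modally definable if it is `Alg Γ` for a set `Γ` of formulas. -/
def IsModallyDefinable {I : Type w} (P : Type v) (𝒞 : Set (ModalAlgebra.{w, u} I)) : Prop :=
  ∃ Γ : Set (Form I P), 𝒞 = Alg Γ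

/-! ### Equations and varieties -/

/-- Terms of the language of modal algebras over a set `X` of variables. -/
inductive Term (I : Type w) (X : Type x) : Type (max w x)
  | var : X → Term I X
  | bot : Term I X
  | top : Term I X
  | compl : Term I X → Term I X
  | sup : Term I X → Term I X → Term I X
  | inf : Term I X → Term I X → Term I X
  | K : I → Term I X → Term I X
  | C : Term I X → Term I X

/-- The value of a term under an assignment of elements to the variables. -/
def Term.eval {I : Type w} {X : Type x} (A : ModalAlgebra.{w, u} I) (val : X → A.carrier) :
    Term I X → A.carrier
  | .var y => val y
  | .bot => ⊥
  | .top => ⊤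
  | .compl s => (Term.eval A val s)ᶜ
  | .sup s t => Term.eval A val s ⊔ Term.eval A val t
  | .inf s t => Term.eval A val s ⊓ Term.eval A val t
  | .K i s => A.K i (Term.eval A val s)
  | .C s => A.C (Term.eval A val s)

/-- A class of modal algebras is equationally definable, with variables from `X`, if it is the
class of all modal algebras that satisfy every equation `e.1 = e.2` of some set of equations. -/
def IsEquationallyDefinable {I : Type w} (X : Type x) (𝒞 : Set (ModalAlgebra.{w, u} I)) : Prop :=
  ∃ Eqs : Set (Term I X × Term I X),
    𝒞 = {A | ∀ e ∈ Eqs, ∀ val : X → A.carrier, Term.eval A val e.1 = Term.eval A val e.2}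

/-- A variety: a class of modal algebras closed under homomorphic images, (isomorphic copies of)
subalgebras, and direct products. -/
structure IsVariety {I : Type w} (𝒞 : Set (ModalAlgebra.{w, u} I)) : Prop where
  image : ∀ (A B : ModalAlgebra.{w, u} I) (f : A.Hom B), Function.Surjective f.toFun →
    A ∈ 𝒞 → B ∈ 𝒞
  subalgebra : ∀ (A B : ModalAlgebra.{w, u} I) (f : A.Hom B), Function.Injective f.toFun →
    B ∈ 𝒞 → A ∈ 𝒞
  product : ∀ (ι : Type u) (A : ι → ModalAlgebra.{w, u} I), (∀ j, A j ∈ 𝒞) →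
    ModalAlgebra.pi A ∈ 𝒞

end CommonKnowledge

namespace CommonKnowledge

namespace ModalAlgebra

variable {I : Type w}

/-! ### The operator `E` and evaluation of compound formulas -/

/-! The MH conditions are the last three axioms read algebraically, and the remaining axioms and the
rules are sound in every modal algebra, so `Alg (CKL I P)` is the class of MH-algebras. In a
CKL-algebra induction holds because an element `x ≤ E x` lies below every iterate of `E` at `x`
(`IsCKL.isMH`).

The negative claims share one cause: formulas and equations survive surjective homomorphisms,
whereas the infinite meet defining `C` need not. In the complex algebra of the predecessor map on
`ℕ`, the number `n` reaches `0` only after `n` steps. Its countable power is a CKL-algebra. Modulo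
cofinite agreement, the germ of `{n}` lies below every `E^k` of the germ of `{0}ᶜ`, but not below
`C` of it (`not_isCKL_reducedPower_ofMap`). This quotient is still an MH-algebra, so it also makes
the inclusion strict. -/

theorem K_mono (A : ModalAlgebra.{w, u} I) (i : I) : Monotone (A.K i) := fun a b h => by
  rw [← inf_eq_left] at h ⊢
  rw [← A.K_inf, h]

theorem C_mono (A : ModalAlgebra.{w, u} I) : Monotone A.C := fun a b h => by
  rw [← inf_eq_left] at h ⊢
  rw [← A.C_inf, h]

theorem le_E_iff [Fintype I] (A : ModalAlgebra.{w, u} I) {a b : A.carrier} :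
    b ≤ A.E a ↔ ∀ i, b ≤ A.K i a := by
  simp [E]

theorem E_mono [Fintype I] (A : ModalAlgebra.{w, u} I) : Monotone A.E := fun _ _ h =>
  A.le_E_iff.2 fun i => (A.le_E_iff.1 le_rfl i).trans (A.K_mono i h)

theorem E_inf [Fintype I] (A : ModalAlgebra.{w, u} I) (a b : A.carrier) :
    A.E (a ⊓ b) = A.E a ⊓ A.E b := by
  refine eq_of_forall_le_iff fun c => ?_
  simp only [le_inf_iff, le_E_iff, A.K_inf, forall_and]

theorem E_eq_of_forall_K_eq [Fintype I] [Nonempty I] (A : ModalAlgebra.{w, u} I)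
    {k : A.carrier → A.carrier} (h : ∀ i, A.K i = k) : A.E = k := by
  funext a
  simp only [E, h]
  exact Finset.inf_const Finset.univ_nonempty _

variable {P : Type v}

theorem eval_or (A : ModalAlgebra.{w, u} I) (val : P → A.carrier) (φ ψ : Form I P) :
    A.eval val (φ.or ψ) = A.eval val φ ⊔ A.eval val ψ := by
  simp [Form.or, eval]

theorem eval_imp (A : ModalAlgebra.{w, u} I) (val : P → A.carrier) (φ ψ : Form I P) :
    A.eval val (φ.imp ψ) = (A.eval val φ)ᶜ ⊔ A.eval val ψ := by
  simp [Form.imp, eval_or, eval]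

theorem eval_imp_eq_top_iff (A : ModalAlgebra.{w, u} I) (val : P → A.carrier) (φ ψ : Form I P) :
    A.eval val (φ.imp ψ) = ⊤ ↔ A.eval val φ ≤ A.eval val ψ := by
  rw [eval_imp, sup_comm, ← himp_eq, himp_eq_top_iff]

theorem eval_E [Fintype I] (A : ModalAlgebra.{w, u} I) (val : P → A.carrier) (φ : Form I P) :
    A.eval val φ.E = A.E (A.eval val φ) := by
  have key (c : A.carrier) (l : List I) :
      c ≤ A.eval val ((l.map fun i => Form.K i φ).foldr Form.and Form.top) ↔
        ∀ i ∈ l, c ≤ A.K i (A.eval val φ) := by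
    induction l with
    | nil => simp [eval]
    | cons i l ih => simp [eval, ih]
  refine eq_of_forall_le_iff fun c => ?_
  rw [Form.E, key, le_E_iff]
  simp

theorem eval_subst (A : ModalAlgebra.{w, u} I) (val : P → A.carrier) (σ : P → Form I P)
    (φ : Form I P) : A.eval val (φ.subst σ) = A.eval (fun p => A.eval val (σ p)) φ := by
  induction φ with
  | var | top | bot => rfl
  | and φ ψ ih₁ ih₂ => simp only [Form.subst, eval, ih₁, ih₂]
  | neg φ ih | K i φ ih | C φ ih => simp only [Form.subst, eval, ih]

/-! ### Soundness of the proof system for MH-algebras -/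

/-- A prime ideal turns a valuation into a classical truth assignment. -/
theorem holds_iff_eval_notMem (A : ModalAlgebra.{w, u} I) (val : P → A.carrier)
    {J : Order.Ideal A.carrier} (hJ : J.IsPrime) (φ : Form I P) :
    φ.Holds (fun ψ => A.eval val ψ ∉ J) ↔ A.eval val φ ∉ J := by
  have top_notMem : (⊤ : A.carrier) ∉ J := hJ.toIsProper.top_notMem
  induction φ with
  | var | K | C => rfl
  | top => simpa [Form.Holds, eval] using top_notMem
  | bot => simp [Form.Holds, eval]
  | and φ ψ ih₁ ih₂ =>
    simp only [Form.Holds, eval, ih₁, ih₂]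
    refine ⟨fun ⟨h₁, h₂⟩ h => (hJ.mem_or_mem h).elim h₁ h₂, fun h => ⟨fun h' => ?_, fun h' => ?_⟩⟩
    · exact h (J.lower inf_le_left h')
    · exact h (J.lower inf_le_right h')
  | neg φ ih =>
    simp only [Form.Holds, eval, ih, not_not]
    refine ⟨fun h h' => top_notMem ?_, fun h => hJ.mem_or_compl_mem.resolve_right h⟩
    simpa using Order.Ideal.sup_mem h h'

/-- A value other than `⊤` generates a proper ideal, which extends to a prime ideal; the classical
assignment given by that ideal refutes the formula. -/
theorem valid_of_isTautology (A : ModalAlgebra.{w, u} I) {φ : Form I P} (h : φ.IsTautology) :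
    A.Valid φ := by
  intro val
  by_contra hne
  have hdisj : Disjoint (Order.PFilter.principal (⊤ : A.carrier) : Set A.carrier)
      (Order.Ideal.principal (A.eval val φ) : Set A.carrier) := by
    refine Set.disjoint_left.2 fun x hx hx' => hne ?_
    exact top_le_iff.1 ((Order.PFilter.mem_principal.1 hx).trans (Order.Ideal.mem_principal.1 hx'))
  obtain ⟨J, hJ, hle, -⟩ := DistribLattice.prime_ideal_of_disjoint_filter_ideal hdisj
  exact (A.holds_iff_eval_notMem val hJ φ).1 (h _) (hle (Order.Ideal.mem_principal.2 le_rfl))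

/-- This is algebraic modus ponens: by residuation it suffices that `f` of the meet of `aᶜ ⊔ b` with
`a` lies below `f b`. It yields the distribution axioms. -/
theorem le_of_map_compl_sup {B : Type u} [BooleanAlgebra B] {f : B → B} (hf : Monotone f)
    (hinf : ∀ a b, f (a ⊓ b) = f a ⊓ f b) (a b : B) : f (aᶜ ⊔ b) ≤ (f a)ᶜ ⊔ f b := by
  rw [sup_comm _ (f b), ← himp_eq, le_himp_iff, ← hinf]
  refine hf ?_
  rw [inf_sup_right]
  simp

theorem IsMH.valid_of_derivable [Fintype I] {A : ModalAlgebra.{w, u} I} (hA : A.IsMH)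
    {φ : Form I P} (h : Derivable φ) : A.Valid φ := by
  induction h with
  | taut h => exact A.valid_of_isTautology h
  | distribK i φ ψ =>
    intro val
    rw [eval_imp_eq_top_iff, eval_imp]
    simp only [eval, eval_imp]
    exact le_of_map_compl_sup (A.K_mono i) (A.K_inf i) _ _
  | distribC φ ψ =>
    intro val
    rw [eval_imp_eq_top_iff, eval_imp]
    simp only [eval, eval_imp]
    exact le_of_map_compl_sup A.C_mono A.C_inf _ _
  | reflC φ => exact fun val => (A.eval_imp_eq_top_iff _ _ _).2 (hA _).1
  | stepC φ =>
    intro val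
    rw [eval_imp_eq_top_iff, eval_E]
    exact (hA _).2.1
  | indC φ =>
    intro val
    rw [eval_imp_eq_top_iff, eval_imp]
    simp only [eval, eval_imp, eval_E]
    exact (hA _).2.2
  | mp _ _ ih₁ ih₂ =>
    intro val
    have := (A.eval_imp_eq_top_iff _ _ _).1 (ih₁ val)
    rwa [ih₂ val, top_le_iff] at this
  | subst σ _ ih =>
    intro val
    rw [eval_subst]
    exact ih _
  | necK i _ ih =>
    intro val
    rw [eval, ih val, A.K_top]
  | necC _ ih =>
    intro val
    rw [eval, ih val, A.C_top]

/-- Each MH condition is one axiom at a single variable, so a constant valuation suffices. -/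
theorem isMH_of_forall_valid [Fintype I] [Nonempty P] {A : ModalAlgebra.{w, u} I}
    (h : ∀ φ ∈ CKL I P, A.Valid φ) : A.IsMH := by
  intro a
  obtain ⟨p⟩ := ‹Nonempty P›
  have h₁ := h _ (Derivable.reflC (Form.var p)) fun _ => a
  have h₂ := h _ (Derivable.stepC (Form.var p)) fun _ => a
  have h₃ := h _ (Derivable.indC (Form.var p)) fun _ => a
  rw [eval_imp_eq_top_iff] at h₁ h₂ h₃
  rw [eval_E] at h₂
  rw [eval_imp] at h₃
  simp only [eval, eval_imp, eval_E] at h₁ h₂ h₃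
  exact ⟨h₁, h₂, h₃⟩

/-- Every CKL-algebra is an MH-algebra. -/
theorem IsCKL.isMH [Fintype I] {A : ModalAlgebra.{w, u} I} (hA : A.IsCKL) : A.IsMH := by
  have C_le (a : A.carrier) : A.C a ≤ a := (hA a).2.1 ⟨0, rfl⟩
  refine fun a => ⟨C_le a, (hA a).1, ?_⟩
  rw [sup_comm _ (A.C a), ← himp_eq, le_himp_iff]
  set d := A.C (aᶜ ⊔ A.E a)
  -- Being below its own image under `E`, the element `d ⊓ a` is below all its iterates, hence is a
  -- lower bound of the iterates of `E` at `a`.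
  have hstep : d ⊓ a ≤ A.E (d ⊓ a) := by
    rw [E_inf]
    refine le_inf (inf_le_left.trans (hA _).1) ?_
    calc d ⊓ a ≤ (aᶜ ⊔ A.E a) ⊓ a := inf_le_inf_right _ (C_le _)
      _ ≤ A.E a := by rw [inf_sup_right]; simp
  refine (hA a).2.2 ?_
  rintro _ ⟨n, rfl⟩
  have hiter : d ⊓ a ≤ A.E^[n] (d ⊓ a) := by
    simpa using A.E_mono.monotone_iterate_of_le_map hstep (Nat.zero_le n)
  exact hiter.trans (A.E_mono.iterate n inf_le_right)

/-! ### Homomorphisms preserve validity of formulas and equations -/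

theorem Hom.map_eval {A B : ModalAlgebra.{w, u} I} (f : A.Hom B) (val : P → A.carrier)
    (φ : Form I P) : f.toFun (A.eval val φ) = B.eval (fun p => f.toFun (val p)) φ := by
  induction φ with
  | var => rfl
  | top => exact f.map_top
  | bot => exact f.map_bot
  | and φ ψ ih₁ ih₂ => simp only [eval, f.map_inf, ih₁, ih₂]
  | neg φ ih => simp only [eval, f.map_compl, ih]
  | K i φ ih => simp only [eval, f.map_K, ih]
  | C φ ih => simp only [eval, f.map_C, ih]

theorem Hom.map_termEval {X : Type x} {A B : ModalAlgebra.{w, u} I} (f : A.Hom B)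
    (val : X → A.carrier) (t : Term I X) :
    f.toFun (t.eval A val) = t.eval B fun y => f.toFun (val y) := by
  induction t with
  | var => rfl
  | bot => exact f.map_bot
  | top => exact f.map_top
  | compl s ih => simp only [Term.eval, f.map_compl, ih]
  | sup s t ih₁ ih₂ => simp only [Term.eval, f.map_sup, ih₁, ih₂]
  | inf s t ih₁ ih₂ => simp only [Term.eval, f.map_inf, ih₁, ih₂]
  | K i s ih => simp only [Term.eval, f.map_K, ih]
  | C s ih => simp only [Term.eval, f.map_C, ih]

/-- Surjectivity lets every valuation in `B` be lifted to `A`. -/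
theorem Hom.valid_of_surjective {A B : ModalAlgebra.{w, u} I} (f : A.Hom B)
    (hf : Function.Surjective f.toFun) {φ : Form I P} (h : A.Valid φ) : B.Valid φ := by
  intro val
  obtain ⟨val, rfl⟩ := hf.comp_left val
  exact (f.map_eval val φ).symm.trans (by rw [h val, f.map_top])

theorem Hom.termEval_eq_of_surjective {X : Type x} {A B : ModalAlgebra.{w, u} I} (f : A.Hom B)
    (hf : Function.Surjective f.toFun) {s t : Term I X}
    (h : ∀ val : X → A.carrier, s.eval A val = t.eval A val) (val : X → B.carrier) :
    s.eval B val = t.eval B val := by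
  obtain ⟨val, rfl⟩ := hf.comp_left val
  exact (f.map_termEval val s).symm.trans (by rw [h val, f.map_termEval]; rfl)

/-! ### Powers and reduced powers -/

/-- The direct power of a modal algebra. -/
def power (ι : Type) (A : ModalAlgebra.{w, u} I) : ModalAlgebra.{w, u} I where
  carrier := ι → A.carrier
  K i a := fun j => A.K i (a j)
  C a := fun j => A.C (a j)
  K_top i := funext fun _ => A.K_top i
  K_inf i a b := funext fun j => A.K_inf i (a j) (b j)
  C_top := funext fun _ => A.C_top
  C_inf a b := funext fun j => A.C_inf (a j) (b j)

theorem power_E [Fintype I] (ι : Type) (A : ModalAlgebra.{w, u} I)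
    (a : (A.power ι).carrier) : (A.power ι).E a = fun j => A.E (a j) := by
  funext j
  exact Finset.inf_apply _ _ _

theorem power_E_iterate [Fintype I] (ι : Type) (A : ModalAlgebra.{w, u} I) (n : ℕ)
    (a : (A.power ι).carrier) : (A.power ι).E^[n] a = fun j => A.E^[n] (a j) := by
  induction n generalizing a with
  | zero => rfl
  | succ n ih =>
    rw [Function.iterate_succ_apply, ih, power_E]
    rfl

/-- Order and operators are coordinatewise, hence so are the greatest lower bounds. -/
theorem IsCKL.power [Fintype I] {A : ModalAlgebra.{w, u} I} (hA : A.IsCKL) (ι : Type) :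
    (A.power ι).IsCKL := by
  intro a
  refine ⟨?_, ?_, ?_⟩
  · rw [power_E]
    exact fun j => (hA (a j)).1
  · rintro _ ⟨n, rfl⟩
    change _ ≤ (A.power ι).E^[n] a
    rw [power_E_iterate]
    exact fun j => (hA (a j)).2.1 ⟨n, rfl⟩
  · intro b hb j
    refine (hA (a j)).2.2 ?_
    rintro _ ⟨n, rfl⟩
    have := hb ⟨n, rfl⟩
    change b ≤ (A.power ι).E^[n] a at this
    rw [power_E_iterate] at this
    exact this j

/-- Germs along a filter with values in a Boolean algebra form a Boolean algebra. -/
instance germBooleanAlgebra {ι : Type*} {β : Type*} [BooleanAlgebra β] (l : Filter ι) :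
    BooleanAlgebra (l.Germ β) where
  __ := (inferInstance : DistribLattice (l.Germ β))
  __ := (inferInstance : BoundedOrder (l.Germ β))
  compl := Filter.Germ.map compl
  inf_compl_le_bot a := by
    induction a using Filter.Germ.inductionOn with | _ f
    exact Filter.Germ.coe_le.2 (.of_forall fun j => inf_compl_self (f j) |>.le)
  top_le_sup_compl a := by
    induction a using Filter.Germ.inductionOn with | _ f
    exact Filter.Germ.coe_le.2 (.of_forall fun j => sup_compl_eq_top (x := f j) |>.ge)

/-- The reduced power of a modal algebra along a filter. -/
def reducedPower {ι : Type} (l : Filter ι) (A : ModalAlgebra.{w, u} I) :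
    ModalAlgebra.{w, u} I where
  carrier := l.Germ A.carrier
  K i := Filter.Germ.map (A.K i)
  C := Filter.Germ.map A.C
  K_top i := congrArg ((↑) : (ι → A.carrier) → l.Germ A.carrier) (funext fun _ => A.K_top i)
  K_inf i a b := Filter.Germ.inductionOn₂ a b fun f g =>
    congrArg ((↑) : (ι → A.carrier) → l.Germ A.carrier) (funext fun j => A.K_inf i (f j) (g j))
  C_top := congrArg ((↑) : (ι → A.carrier) → l.Germ A.carrier) (funext fun _ => A.C_top)
  C_inf a b := Filter.Germ.inductionOn₂ a b fun f g =>
    congrArg ((↑) : (ι → A.carrier) → l.Germ A.carrier) (funext fun j => A.C_inf (f j) (g j))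

/-- The quotient map from a power to a reduced power. -/
def toReducedPower {ι : Type} (l : Filter ι) (A : ModalAlgebra.{w, u} I) :
    (A.power ι).Hom (A.reducedPower l) where
  toFun a := Filter.Germ.ofFun (l := l) (β := A.carrier) a
  map_sup _ _ := rfl
  map_inf _ _ := rfl
  map_compl _ := rfl
  map_bot := rfl
  map_top := rfl
  map_K _ _ := rfl
  map_C _ := rfl

theorem toReducedPower_surjective {ι : Type} (l : Filter ι) (A : ModalAlgebra.{w, u} I) :
    Function.Surjective (A.toReducedPower l).toFun := fun a =>
  Filter.Germ.inductionOn a fun f => ⟨f, rfl⟩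

theorem reducedPower_E_coe [Fintype I] [Nonempty I] {ι : Type} (l : Filter ι)
    (A : ModalAlgebra.{w, u} I) {k : A.carrier → A.carrier} (h : ∀ i, A.K i = k) :
    (A.reducedPower l).E = Filter.Germ.map k :=
  E_eq_of_forall_K_eq _ fun i => by rw [← h i]; rfl

/-! ### A CKL-algebra with a homomorphic image that is not a CKL-algebra -/

/-- The complex algebra of the graph of a function `f`: every `K i` is the preimage under `f`, and
`C` is truth along the whole forward orbit. -/
def ofMap (I : Type w) {W : Type u} (f : W → W) : ModalAlgebra.{w, u} I where
  carrier := Set W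
  K _ s := f ⁻¹' s
  C s := ⋂ n : ℕ, f^[n] ⁻¹' s
  K_top _ := rfl
  K_inf _ _ _ := rfl
  C_top := by simp
  C_inf s t := by simp [Set.iInter_inter_distrib]

theorem ofMap_E_iterate [Fintype I] [Nonempty I] {W : Type u} (f : W → W) (n : ℕ) (s : Set W) :
    (ofMap I f).E^[n] s = f^[n] ⁻¹' s := by
  have hE : (ofMap I f).E = Set.preimage f := E_eq_of_forall_K_eq _ fun _ => rfl
  rw [hE]
  exact congrFun (Set.preimage_iterate_eq (f := f) (n := n)).symm s

theorem ofMap_isCKL [Fintype I] [Nonempty I] {W : Type u} (f : W → W) : (ofMap I f).IsCKL := by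
  intro s
  constructor
  · refine (le_E_iff _).2 fun _ => ?_
    change (⋂ n : ℕ, f^[n] ⁻¹' s) ⊆ f ⁻¹' ⋂ n : ℕ, f^[n] ⁻¹' s
    intro y hy
    simp only [Set.preimage_iInter, Set.mem_iInter, Set.mem_preimage] at hy ⊢
    exact fun n => hy (n + 1)
  · have h : (fun n : ℕ => (ofMap I f).E^[n] s) = fun n : ℕ => f^[n] ⁻¹' s :=
      funext fun n => ofMap_E_iterate f n s
    rw [h]
    exact isGLB_iInf (f := fun n : ℕ => f^[n] ⁻¹' s)

/-- The points `z n` reach `r` eventually, but with unbounded delay. Each fixed `k` rules out only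
finitely many indices, which the filter ignores, whereas `C` looks at all steps at once. -/
theorem not_isCKL_reducedPower_ofMap (I : Type w) [Fintype I] [Nonempty I] {W : Type u}
    (f : W → W) (r : W) (z : ℕ → W) (hz : ∀ n, f^[n] (z n) = r)
    (hz' : ∀ k n, k < n → f^[k] (z n) ≠ r) :
    ¬ ((ofMap I f).reducedPower (Filter.atTop : Filter ℕ)).IsCKL := by
  intro h
  let l : Filter ℕ := Filter.atTop
  let a : ℕ → Set W := fun _ => {r}ᶜ
  let b : ℕ → Set W := fun n => {z n}
  have hE (k : ℕ) : ((ofMap I f).reducedPower l).E^[k] (a : l.Germ (Set W)) =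
      ((fun _ => f^[k] ⁻¹' {r}ᶜ : ℕ → Set W) : l.Germ (Set W)) := by
    have hE : ((ofMap I f).reducedPower l).E = Filter.Germ.map (Set.preimage f) :=
      reducedPower_E_coe l (ofMap I f) fun _ => rfl
    rw [hE]
    induction k with
    | zero => rfl
    | succ k ih =>
      exact (Function.iterate_succ_apply' _ k _).trans (congrArg (Filter.Germ.map (f ⁻¹' ·)) ih)
  have hle : (b : l.Germ (Set W)) ≤
      ((fun _ => ⋂ n : ℕ, f^[n] ⁻¹' {r}ᶜ : ℕ → Set W) : l.Germ (Set W)) := by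
    refine (h (a : l.Germ (Set W))).2.2 ?_
    rintro _ ⟨k, rfl⟩
    change (b : l.Germ (Set W)) ≤ ((ofMap I f).reducedPower l).E^[k] (a : l.Germ (Set W))
    rw [hE]
    refine Filter.Germ.coe_le.2 ((Filter.eventually_gt_atTop k).mono fun n hn => ?_)
    rintro _ rfl
    exact hz' k n hn
  obtain ⟨n, hn⟩ := (Filter.Germ.coe_le.1 hle).exists
  -- One index `n` where the inequality holds is enough: `z n` would avoid `r` at step `n`, where it
  -- equals `r`.
  exact Set.mem_iInter.1 (hn (Set.mem_singleton (z n))) n (hz n)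

/-- Some CKL-algebra has a homomorphic image that is not a CKL-algebra. -/
theorem exists_isCKL_surjective_not_isCKL (I : Type w) [Fintype I] [Nonempty I] :
    ∃ (A B : ModalAlgebra.{w, u} I) (f : A.Hom B),
      Function.Surjective f.toFun ∧ A.IsCKL ∧ ¬ B.IsCKL := by
  -- Subtraction is truncated, so `0` is fixed and `n` first reaches it at step `n`.
  let f : ULift.{u} ℕ → ULift.{u} ℕ := fun m => ⟨m.down - 1⟩
  have hf (k m : ℕ) : f^[k] ⟨m⟩ = ⟨m - k⟩ := by
    induction k with
    | zero => rfl
    | succ k ih =>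
      rw [Function.iterate_succ_apply', ih]
      rfl
  refine ⟨(ofMap I f).power ℕ, (ofMap I f).reducedPower (Filter.atTop : Filter ℕ),
    toReducedPower _ _, toReducedPower_surjective _ _, (ofMap_isCKL f).power ℕ,
    not_isCKL_reducedPower_ofMap I f ⟨0⟩ (fun n => ⟨n⟩) (fun n => by simp [hf]) fun k n hkn => ?_⟩
  rw [hf, Ne, ULift.up_inj]
  omega

end ModalAlgebra

theorem alg_CKL_eq_MHAlgebras (I : Type w) [Fintype I] (P : Type v) [Nonempty P] :
    (Alg (CKL I P) : Set (ModalAlgebra.{w, u} I)) = MHAlgebras I :=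
  Set.ext fun _ => ⟨fun h => ModalAlgebra.isMH_of_forall_valid h,
    fun h _ hφ => ModalAlgebra.IsMH.valid_of_derivable h hφ⟩

end CommonKnowledge

theorem mainTheorem2 (I : Type w) [Fintype I] [Nonempty I]
    (P : Type v) [Countable P] [Infinite P] :
    (CommonKnowledge.Alg (CommonKnowledge.CKL I P) : Set (CommonKnowledge.ModalAlgebra.{w, u} I))
        = CommonKnowledge.MHAlgebras I ∧
      (CommonKnowledge.CKLAlgebras I : Set (CommonKnowledge.ModalAlgebra.{w, u} I))
        ⊂ CommonKnowledge.MHAlgebras I ∧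
      ¬ CommonKnowledge.IsModallyDefinable P
        (CommonKnowledge.CKLAlgebras I : Set (CommonKnowledge.ModalAlgebra.{w, u} I)) ∧
      (∀ X : Type x, ¬ CommonKnowledge.IsEquationallyDefinable X
        (CommonKnowledge.CKLAlgebras I : Set (CommonKnowledge.ModalAlgebra.{w, u} I))) ∧
      ¬ CommonKnowledge.IsVariety
        (CommonKnowledge.CKLAlgebras I : Set (CommonKnowledge.ModalAlgebra.{w, u} I)) := by
  obtain ⟨A, B, f, hf, hA, hB⟩ :=
    CommonKnowledge.ModalAlgebra.exists_isCKL_surjective_not_isCKL.{w, u} I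
  have hAlg := CommonKnowledge.alg_CKL_eq_MHAlgebras.{w, v, u} I P
  -- Through `Alg`, being an MH-algebra becomes validity of formulas, which passes to the quotient
  -- `B`.
  have hA_MH : A ∈ CommonKnowledge.Alg (CommonKnowledge.CKL I P) := hAlg ▸ hA.isMH
  have hB_MH : B ∈ CommonKnowledge.MHAlgebras I :=
    hAlg ▸ fun φ hφ => f.valid_of_surjective hf (hA_MH φ hφ)
  refine ⟨hAlg, ⟨fun _ h => CommonKnowledge.ModalAlgebra.IsCKL.isMH h, fun h => hB (h hB_MH)⟩,
    ?_, ?_, fun h => hB (h.image A B f hf hA)⟩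
  · rintro ⟨Γ, hΓ⟩
    have hAΓ : A ∈ CommonKnowledge.Alg Γ := hΓ ▸ hA
    have hBΓ : B ∈ CommonKnowledge.Alg Γ := fun φ hφ => f.valid_of_surjective hf (hAΓ φ hφ)
    rw [← hΓ] at hBΓ
    exact hB hBΓ
  · rintro X ⟨Eqs, hEqs⟩
    have hA' : A ∈ CommonKnowledge.CKLAlgebras I := hA
    rw [hEqs] at hA'
    have hB' : B ∈ CommonKnowledge.CKLAlgebras I := by
      rw [hEqs]
      exact fun e he val => f.termEval_eq_of_surjective hf (hA' e he) val
    exact hB hB'
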